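/- Let $K=\bigcup_{l=1}^m K_l\subseteq\mathbb{R}^n$ with $$K_l=\{x\in\mathbb{R}^n : c_i^{(l)}(x)=0\ (i\in\mathcal{E}^{(l)}),\ c_j^{(l)}(x)\ge 0\ (j\in\mathcal{I}^{(l)})\},$$ where $\mathcal{E}^{(l)},\mathcal{I}^{(l)}$ are finite and $f,c_i^{(l)}$ are real polynomials, and let $f_{min}=\inf_{x\in K}f(x)$. For $\alpha\in\mathbb{N}^n$ let $|\alpha|=\alpha_1+\dots+\alpha_n$, and let $\mathbb{N}^n_d=\{\alpha\in\mathbb{N}^n:|\alpha|\le d\}$. For $y\in\mathbb{R}^{\mathbb{N}^n_{2k}}$ and a polynomial $p=\sum_\alpha p_\alpha x^\alpha$ of degree at most $2k$, let $\langle p,y\rangle=\sum_\alpha p_\alpha y_\alpha$. Let $$\mathscr{V}_p^{(2k)}[y]=\big(\langle p\,x^\alpha,y\rangle\big)_{|\alpha|\le 2k-\deg p},\qquad L_p^{(k)}[y]=\big(\langle p\,x^{\alpha+\beta},y\rangle\big)_{|\alpha|,|\beta|\le k-\lceil\deg(p)/2\rceil},$$ and $M_s[y]=(y_{\alpha+\beta})_{|\alpha|,|\beta|\le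 s}$ for $s\le k$. The unified moment relaxation of order $k$ is to minimize $\sum_{l=1}^m\langle f,y^{(l)}\rangle$ over all tuples $(y^{(1)},\dots,y^{(m)})$ of vectors $y^{(l)}\in\mathbb{R}^{\mathbb{N}^n_{2k}}$ with $\sum_{l=1}^m y^{(l)}_0=1$ such that, for each $l$, $\mathscr{V}^{(2k)}_{c_i^{(l)}}[y^{(l)}]=0$ $(i\in\mathcal{E}^{(l)})$, $L^{(k)}_{c_j^{(l)}}[y^{(l)}]\succeq0$ $(j\in\mathcal{I}^{(l)})$ and $M_k[y^{(l)}]\succeq0$. Let $f_{mom,k}$ be its optimal value. Let $$d_l=\max\Big(\{1\}\cup\{\lceil\deg(c_i^{(l)})/2\rceil : i\in\mathcal{E}^{(l)}\cup\mathcal{I}^{(l)}\}\Big).$$ **Theorem.** Let $y^*=(y^{(*,1)},\dots,y^{(*,m)})$ be a minimizer of the unified moment relaxation of order $k$ and let $\mathcal{A}=\{l : y^{(*,l)}_0>0\}$. Suppose that there is an integer $t\le k$ with $t\ge d_l$ for all $l=1,\dots,m$ and $t\ge\deg(f)/2$ such that $$\operatorname{rank}M_{t-d_l}[y^{(*,l)}]=\operatorname{rank}M_t[y^{(*,l)}]\qquad\text{for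 each } l\in\mathcal{A}.$$ Then the moment relaxation is tight, that is, $f_{mom,k}=f_{min}$. Moreover, for each $l\in\mathcal{A}$ there is a Borel measure $\mu^{(l)}$ on $\mathbb{R}^n$ that is $r_l$-atomic with $r_l=\operatorname{rank}M_t[y^{(*,l)}]$ (a sum of $r_l$ point masses with positive weights at distinct points), is supported in $K_l$, and represents the truncation $y^{(*,l)}|_{2t}$, that is, $y^{(*,l)}_\alpha=\int x^\alpha\,d\mu^{(l)}$ for all $|\alpha|\le 2t$. Every point of $\operatorname{supp}\mu^{(l)}$ is a global minimizer of $f$ on $K$. Hence the total number of minimizers so obtained, counted once for each $l\in\mathcal{A}$ in whose support they occur (that is, the number of pairs $(l,u)$ with $l\in\mathcal{A}$ and $u\in\operatorname{supp}\mu^{(l)}$), is $r=\sum_{l\in\mathcal{A}}r_l$. If the sets $K_l$ $(l\in\mathcal{A})$ are pairwise disjoint, then these are $r$ distinct minimizers. -/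

import Mathlib

open MeasureTheory

noncomputable section

/-- `ℕ^n_d`: the exponents `α ∈ ℕ^n` with `|α| ≤ d`. -/
abbrev PowIdx (n d : ℕ) : Type := {α : Fin n →₀ ℕ // α.degree ≤ d}

instance PowIdx.instFintype (n d : ℕ) : Fintype (PowIdx n d) :=
  (Finsupp.finite_of_degree_le (σ := Fin n) d).fintype

/-- Truncated multi-sequences of degree `d`: real vectors labelled by `ℕ^n_d`. -/
abbrev Tms (n d : ℕ) : Type := PowIdx n d → ℝ

namespace Tms

variable {n d : ℕ}

/-- The entry `y_0`. -/
def zeroth (y : Tms n d) : ℝ := y ⟨0, by simp⟩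

/-- The subvector `y|_e` of the entries labelled by `ℕ^n_e`, for `e ≤ d`. -/
def truncate {e : ℕ} (h : e ≤ d) (y : Tms n d) : Tms n e :=
  fun α => y ⟨α.1, α.2.trans h⟩

/-- The Riesz functional `⟨p, y⟩ = ∑_{|α| ≤ d} p_α y_α`, for polynomials `p` of degree at
most `d`. -/
def riesz (y : Tms n d) (p : MvPolynomial (Fin n) ℝ) : ℝ :=
  ∑ α : PowIdx n d, p.coeff α.1 * y α

end Tms

/-- `⌈deg(p)/2⌉`. -/
def halfDeg {n : ℕ} (p : MvPolynomial (Fin n) ℝ) : ℕ := (p.totalDegree + 1) / 2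

/-- The monomial `x^α`. -/
def mono {n : ℕ} (α : Fin n →₀ ℕ) : MvPolynomial (Fin n) ℝ := MvPolynomial.monomial α 1

/-- The localizing matrix `L_p^{(k)}[y] = 𝓛_y(p · [x]_s [x]_sᵀ)` with `s = k - ⌈deg(p)/2⌉`.
It is meant for `2 * k ≤ d` and `deg p ≤ 2 * k`; then every polynomial to which the Riesz functional
is applied has degree at most `d`. -/
def localizingMatrix {n d : ℕ} (k : ℕ) (p : MvPolynomial (Fin n) ℝ) (y : Tms n d) :
    Matrix (PowIdx n (k - halfDeg p)) (PowIdx n (k - halfDeg p)) ℝ :=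
  Matrix.of fun α β => y.riesz (p * (mono α.1 * mono β.1))

/-- The moment matrix `M_k[y] = 𝓛_y([x]_k [x]_kᵀ)`, for `2 * k ≤ d`. It is the localizing matrix of
`p = 1`. -/
def momentMatrix {n d : ℕ} (k : ℕ) (y : Tms n d) : Matrix (PowIdx n k) (PowIdx n k) ℝ :=
  Matrix.of fun α β => y.riesz (mono α.1 * mono β.1)

/-- The localizing vector `𝓥_p^{(2k)}[y] = 𝓛_y(p · [x]_s)` with `s = 2k - deg(p)`, for a tms of degree
`e = 2k` and `deg p ≤ 2k`. -/
def localizingVector {n e : ℕ} (p : MvPolynomial (Fin n) ℝ) (y : Tms n e) :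
    PowIdx n (e - p.totalDegree) → ℝ :=
  fun α => y.riesz (p * mono α.1)

/-- The tms `y` admits the Borel measure `μ` on `ℝ^n`: all moments of degree at most `d` exist
and are the entries of `y`. -/
def Tms.Admits {n d : ℕ} (y : Tms n d) (μ : Measure (Fin n → ℝ)) : Prop :=
  ∀ α : PowIdx n d, Integrable (fun x : Fin n → ℝ => ∏ i, x i ^ α.1 i) μ ∧
    y α = ∫ x, ∏ i, x i ^ α.1 i ∂μ

/-- `μ` is an `r`-atomic measure: `μ = ∑_{u ∈ S} λ_u δ_u` with `r` distinct points `u` and weights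
`λ_u > 0`. -/
def IsAtomicMeasure {n : ℕ} (r : ℕ) (μ : Measure (Fin n → ℝ)) : Prop :=
  ∃ (S : Finset (Fin n → ℝ)) (w : (Fin n → ℝ) → ℝ), S.card = r ∧ (∀ u ∈ S, 0 < w u) ∧
    μ = ∑ u ∈ S, ENNReal.ofReal (w u) • Measure.dirac u

/-- The data of the problem of minimizing `f` over `K = K_1 ∪ ⋯ ∪ K_m`, where
`K_l = {x : c_i^{(l)}(x) = 0 (i ∈ E^{(l)}), c_j^{(l)}(x) ≥ 0 (j ∈ I^{(l)})}` and `E^{(l)}`, `I^{(l)}`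
are finite sets of labels. -/
structure UnionProblem (n m : ℕ) where
  f : MvPolynomial (Fin n) ℝ
  E : Fin m → Finset ℕ
  I : Fin m → Finset ℕ
  c : Fin m → ℕ → MvPolynomial (Fin n) ℝ

namespace UnionProblem

variable {n m : ℕ} (P : UnionProblem n m)

/-- The basic closed semialgebraic set `K_l`. -/
def K (l : Fin m) : Set (Fin n → ℝ) :=
  {x | (∀ i ∈ P.E l, MvPolynomial.eval x (P.c l i) = 0) ∧
       (∀ j ∈ P.I l, 0 ≤ MvPolynomial.eval x (P.c l j))}

/-- The feasible set `K = K_1 ∪ ⋯ ∪ K_m`. -/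
def feasibleSet : Set (Fin n → ℝ) := ⋃ l, P.K l

/-- `u` is a (global) minimizer of `f` over `K`. -/
def IsMinimizer (u : Fin n → ℝ) : Prop :=
  u ∈ P.feasibleSet ∧ ∀ x ∈ P.feasibleSet, MvPolynomial.eval u P.f ≤ MvPolynomial.eval x P.f

/-- The optimal value `f_min`, in the extended reals. -/
def fMin : EReal := ⨅ x ∈ P.feasibleSet, ((MvPolynomial.eval x P.f : ℝ) : EReal)

/-- Feasibility of `(y^{(1)}, …, y^{(m)})` in the unified moment relaxation of order `k`. -/
structure IsFeasible (k : ℕ) (y : Fin m → Tms n (2 * k)) : Prop where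
  eq_constraint : ∀ l, ∀ i ∈ P.E l, localizingVector (P.c l i) (y l) = 0
  ineq_constraint : ∀ l, ∀ j ∈ P.I l, (localizingMatrix k (P.c l j) (y l)).PosSemidef
  moment : ∀ l, (momentMatrix k (y l)).PosSemidef
  mass : ∑ l, (y l).zeroth = 1

/-- The objective `⟨f, y^{(1)}⟩ + ⋯ + ⟨f, y^{(m)}⟩`. -/
def objective {k : ℕ} (y : Fin m → Tms n (2 * k)) : ℝ := ∑ l, (y l).riesz P.f

/-- `y` is a minimizer of the unified moment relaxation of order `k`. -/
def IsRelaxationMinimizer (k : ℕ) (y : Fin m → Tms n (2 * k)) : Prop :=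
  P.IsFeasible k y ∧ ∀ z, P.IsFeasible k z → P.objective y ≤ P.objective z

/-- The optimal value `f_{mom,k}` of the unified moment relaxation, in the extended reals. -/
def fMom (k : ℕ) : EReal :=
  ⨅ (y : Fin m → Tms n (2 * k)) (_ : P.IsFeasible k y), ((P.objective y : ℝ) : EReal)

/-- The degree `d_l`, the maximum of the `⌈deg(c_i^{(l)})/2⌉`. By the usual convention `d_l = 1` when
there is no constraint of positive degree; otherwise the `1` has no effect. -/
def degBound (l : Fin m) : ℕ := max 1 ((P.E l ∪ P.I l).sup fun i => halfDeg (P.c l i))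

end UnionProblem

/-- The labels `l` with `y_0^{(l)} > 0`. -/
def activeLabels {n m d : ℕ} (y : Fin m → Tms n d) : Set (Fin m) := {l | 0 < (y l).zeroth}

end

noncomputable section

open scoped InnerProductSpace MatrixOrder

/-! Fix an active label and write its `M_t` as the Gram matrix of vectors in a Euclidean space of
dimension `rank M_t`. Flatness says that the classes of polynomials of degree at most `t - d_l`
already fill this space. Multiplication by each variable therefore induces well-defined, symmetric,
commuting operators. Splitting the class of `1` into joint eigenvectors turns the Riesz functional
into a positive combination of evaluations at the tuples of joint eigenvalues
(`exists_atoms_of_flat`). Each atom is isolated by a polynomial `p` of degree at most `t - d_l`, and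
applying the functional to `c * p ^ 2` tests the constraint `c` at that atom alone, so the atoms lie
in `K_l` (`UnionProblem.IsFeasible.exists_atoms`).

Globally, the weights of all atoms sum to `1`, because components of mass zero contribute nothing to
the mass, nor to the objective (`UnionProblem.IsRelaxationMinimizer.riesz_eq_zero`). The optimal
value is thus a convex combination of values of `f` on `K`. It is also a lower bound for `f` on `K`,
since point evaluations are feasible, so every atom attains it. -/

/-! ### Gram factorization of positive semidefinite matrices -/

/-- The rank of a Gram matrix is the dimension of the span of its vectors. -/
theorem rank_gram_eq_finrank_span {ι E : Type*} [Fintype ι] [NormedAddCommGroup E]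
    [InnerProductSpace ℝ E] [FiniteDimensional ℝ E] (v : ι → E) :
    (Matrix.gram ℝ v).rank = Module.finrank ℝ (Submodule.span ℝ (Set.range v)) := by
  classical
  let b := stdOrthonormalBasis ℝ E
  rw [Matrix.gram_eq_conjTranspose_mul b, Matrix.rank_conjTranspose_mul_self,
    Matrix.rank_eq_finrank_span_cols]
  let e := b.repr.toLinearEquiv.trans (WithLp.linearEquiv 2 ℝ (Fin (Module.finrank ℝ E) → ℝ))
  have h : Set.range (Matrix.of fun i j => b.repr (v j) i).col = e '' Set.range v := by
    rw [← Set.range_comp]; rfl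
  rw [h, ← LinearEquiv.coe_coe, ← Submodule.map_span, LinearEquiv.finrank_map_eq]

/-- A positive semidefinite real matrix is the Gram matrix of a family of vectors in a space
whose dimension is its rank. -/
theorem Matrix.PosSemidef.exists_gram {ι : Type*} [Fintype ι]
    {M : Matrix ι ι ℝ} (hM : M.PosSemidef) :
    ∃ v : ι → EuclideanSpace ℝ (Fin M.rank), Matrix.gram ℝ v = M := by
  classical
  obtain ⟨B, hB⟩ := CStarAlgebra.nonneg_iff_eq_star_mul_self.1 hM.nonneg
  let v₀ : ι → EuclideanSpace ℝ ι := fun i => WithLp.toLp 2 (B.col i)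
  have hv₀ : Matrix.gram ℝ v₀ = M := by
    ext i j
    simp [v₀, hB, Matrix.star_eq_conjTranspose, Matrix.mul_apply, PiLp.inner_apply, mul_comm]
  -- The columns of `B` live in a space of dimension `card ι`; passing to their span lowers this to
  -- the rank and keeps inner products.
  let F := Submodule.span ℝ (Set.range v₀)
  have hF : Module.finrank ℝ F = M.rank := by rw [← hv₀, rank_gram_eq_finrank_span]
  let e : F ≃ₗᵢ[ℝ] EuclideanSpace ℝ (Fin M.rank) :=
    (stdOrthonormalBasis ℝ F).repr.trans
      (LinearIsometryEquiv.piLpCongrLeft 2 ℝ ℝ (finCongr hF))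
  let v₁ : ι → F := fun i => ⟨v₀ i, Submodule.subset_span ⟨i, rfl⟩⟩
  refine ⟨fun i => e (v₁ i), Eq.trans ?_ hv₀⟩
  ext i j
  simp [v₁]

/-! ### Riesz functionals and monomials -/

/-- The Riesz functional of a truncated multi-sequence as a linear map. -/
def Tms.rieszₗ {n d : ℕ} (y : Tms n d) : MvPolynomial (Fin n) ℝ →ₗ[ℝ] ℝ where
  toFun := y.riesz
  map_add' p q := by simp [Tms.riesz, add_mul, Finset.sum_add_distrib]
  map_smul' a p := by simp [Tms.riesz, mul_assoc, Finset.mul_sum]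

@[simp]
theorem Tms.rieszₗ_apply {n d : ℕ} (y : Tms n d) (p : MvPolynomial (Fin n) ℝ) :
    y.rieszₗ p = y.riesz p := rfl

theorem Tms.riesz_mono {n d : ℕ} (y : Tms n d) (α : PowIdx n d) : y.riesz (mono α.1) = y α := by
  classical
  simp [Tms.riesz, mono, MvPolynomial.coeff_monomial, Subtype.coe_inj]

theorem mono_mul_mono {n : ℕ} (α β : Fin n →₀ ℕ) : mono α * mono β = mono (α + β) := by
  simp [mono, MvPolynomial.monomial_mul]

theorem eval_mono {n : ℕ} (α : Fin n →₀ ℕ) (x : Fin n → ℝ) :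
    MvPolynomial.eval x (mono α) = ∏ i, x i ^ α i := by
  simp [mono, MvPolynomial.eval_monomial, Finsupp.prod_fintype]

theorem totalDegree_mono {n : ℕ} (α : Fin n →₀ ℕ) : (mono α).totalDegree = α.degree := by
  rw [mono, MvPolynomial.totalDegree_monomial _ one_ne_zero, Finsupp.degree_eq_sum,
    Finsupp.sum_fintype _ _ (by simp)]

theorem sum_coeff_smul_mono {n s : ℕ} {p : MvPolynomial (Fin n) ℝ} (hp : p.totalDegree ≤ s) :
    ∑ α : PowIdx n s, p.coeff α.1 • mono α.1 = p := by
  classical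
  ext γ
  simp only [MvPolynomial.coeff_sum, MvPolynomial.coeff_smul, mono, MvPolynomial.coeff_monomial,
    smul_eq_mul, mul_ite, mul_one, mul_zero]
  by_cases hγ : γ.degree ≤ s
  · rw [Finset.sum_eq_single ⟨γ, hγ⟩ (fun b _ hb => if_neg fun h => hb (Subtype.ext h))
      (by simp), if_pos rfl]
  · rw [MvPolynomial.coeff_eq_zero_of_totalDegree_lt, Finset.sum_eq_zero]
    · exact fun α _ => if_neg fun h : α.1 = γ => hγ (h ▸ α.2)
    · rw [Finsupp.degree_apply] at hγ
      omega

/-- Linear maps which agree on the monomials of degree at most `s` agree on the polynomials of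
degree at most `s`. -/
theorem LinearMap.eq_of_eq_on_mono {n s : ℕ} {V : Type*} [AddCommMonoid V] [Module ℝ V]
    {F G : MvPolynomial (Fin n) ℝ →ₗ[ℝ] V}
    (h : ∀ α : Fin n →₀ ℕ, α.degree ≤ s → F (mono α) = G (mono α))
    {p : MvPolynomial (Fin n) ℝ} (hp : p.totalDegree ≤ s) : F p = G p := by
  rw [← sum_coeff_smul_mono hp, map_sum, map_sum]
  exact Finset.sum_congr rfl fun α _ => by rw [map_smul, map_smul, h _ α.2]

/-- An exponent of degree `d + 1` is the sum of a unit exponent and one of degree `d`. -/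
theorem Finsupp.exists_eq_single_add_of_degree_eq_succ {n d : ℕ} {α : Fin n →₀ ℕ}
    (h : α.degree = d + 1) : ∃ i β, α = Finsupp.single i 1 + β ∧ β.degree = d := by
  have h0 : α ≠ 0 := by rintro rfl; simp at h
  obtain ⟨i, hi⟩ := Finsupp.ne_iff.1 h0
  have hle : Finsupp.single i 1 ≤ α := by
    rw [Finsupp.single_le_iff]
    exact Nat.one_le_iff_ne_zero.2 hi
  obtain ⟨β, rfl⟩ := exists_add_of_le hle
  exact ⟨i, β, rfl, by simpa [add_comm 1] using h⟩

theorem Finsupp.exists_add_of_degree_le {n a b : ℕ} {γ : Fin n →₀ ℕ} (h : γ.degree ≤ a + b) :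
    ∃ α β, γ = α + β ∧ α.degree ≤ a ∧ β.degree ≤ b := by
  induction a generalizing γ with
  | zero => exact ⟨0, γ, by simp, by simp, by omega⟩
  | succ a ih =>
    by_cases h' : γ.degree ≤ a + b
    · obtain ⟨α, β, h1, h2, h3⟩ := ih h'
      exact ⟨α, β, h1, h2.trans a.le_succ, h3⟩
    · obtain ⟨i, δ, rfl, hδ⟩ :=
        Finsupp.exists_eq_single_add_of_degree_eq_succ (show γ.degree = (a + b) + 1 by omega)
      obtain ⟨α, β, rfl, h2, h3⟩ := ih hδ.le
      exact ⟨_, β, (add_assoc _ _ _).symm, by simp; omega, h3⟩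

theorem riesz_mul_eq_sum {n d s : ℕ} (y : Tms n d) (c : MvPolynomial (Fin n) ℝ)
    {p q : MvPolynomial (Fin n) ℝ} (hp : p.totalDegree ≤ s) (hq : q.totalDegree ≤ s) :
    y.riesz (c * (p * q)) = ∑ α : PowIdx n s, ∑ β : PowIdx n s,
      q.coeff β.1 * (p.coeff α.1 * y.riesz (c * (mono α.1 * mono β.1))) := by
  conv_lhs => rw [← sum_coeff_smul_mono hp, ← sum_coeff_smul_mono hq, Finset.sum_mul_sum]
  simp only [← Tms.rieszₗ_apply, Finset.mul_sum, map_sum, smul_mul_assoc,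
    mul_smul_comm, map_smul, smul_eq_mul]

/-! ### Flat extension through multiplication operators -/

section FlatExtension

variable {n t : ℕ} {E : Type*} [NormedAddCommGroup E] [InnerProductSpace ℝ E]
  [FiniteDimensional ℝ E]

/-- In a flat Gram realization of a linear functional on polynomials, multiplication by the
variables induces commuting symmetric operators. -/
theorem exists_multiplication_operators (φ : MvPolynomial (Fin n) ℝ →ₗ[ℝ] E)
    (Λ : MvPolynomial (Fin n) ℝ →ₗ[ℝ] ℝ)
    (hφ : ∀ p q, p.totalDegree ≤ t + 1 → q.totalDegree ≤ t + 1 → ⟪φ p, φ q⟫_ℝ = Λ (p * q))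
    (hsurj : ∀ v, ∃ p, p.totalDegree ≤ t ∧ φ p = v) :
    ∃ T : Fin n → E →ₗ[ℝ] E, (∀ i, (T i).IsSymmetric) ∧ Pairwise (Function.onFun Commute T) ∧
      ∀ i p, p.totalDegree ≤ t → φ (MvPolynomial.X i * p) = T i (φ p) := by
  let W := MvPolynomial.restrictTotalDegree (Fin n) ℝ t
  have hW (p : W) : p.1.totalDegree ≤ t := (MvPolynomial.mem_restrictTotalDegree _ _ _).1 p.2
  have hX (i : Fin n) {p : MvPolynomial (Fin n) ℝ} (hp : p.totalDegree ≤ t) :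
      (MvPolynomial.X i * p).totalDegree ≤ t + 1 := by
    grw [MvPolynomial.totalDegree_mul, MvPolynomial.totalDegree_X, hp, add_comm]
  -- `g` picks linearly a representative of degree at most `t` for each vector, so that multiplying
  -- it by a variable stays within degree `t + 1`.
  obtain ⟨g, hg⟩ := (φ ∘ₗ W.subtype).exists_rightInverse_of_surjective (by
    refine LinearMap.range_eq_top.2 fun v => ?_
    obtain ⟨p, hp, rfl⟩ := hsurj v
    exact ⟨⟨p, (MvPolynomial.mem_restrictTotalDegree _ _ _).2 hp⟩, rfl⟩)
  have hg' (v : E) : φ (g v).1 = v := LinearMap.congr_fun hg v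
  let T (i : Fin n) : E →ₗ[ℝ] E :=
    φ ∘ₗ LinearMap.mulLeft ℝ (MvPolynomial.X i) ∘ₗ W.subtype ∘ₗ g
  have hT (i : Fin n) (v : E) : T i v = φ (MvPolynomial.X i * (g v).1) := rfl
  have hinner (i : Fin n) {p q : MvPolynomial (Fin n) ℝ} (hp : p.totalDegree ≤ t)
      (hq : q.totalDegree ≤ t) :
      ⟪φ (MvPolynomial.X i * p), φ q⟫_ℝ = ⟪φ p, φ (MvPolynomial.X i * q)⟫_ℝ := by
    rw [hφ _ _ (hX i hp) (hq.trans t.le_succ), hφ _ _ (hp.trans t.le_succ) (hX i hq)]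
    congr 1
    ring
  -- Independence of the representative: against any `φ q` with `deg q ≤ t`, the variable moves onto
  -- `q`, leaving an expression that depends on `p` only through `φ p`.
  have hmul (i : Fin n) (p : MvPolynomial (Fin n) ℝ) (hp : p.totalDegree ≤ t) :
      φ (MvPolynomial.X i * p) = T i (φ p) := by
    refine ext_inner_right ℝ fun v => ?_
    rw [hT, ← hg' v, hinner i hp (hW _), hinner i (hW _) (hW _), hg' (φ p)]
  have hsymm (i : Fin n) : (T i).IsSymmetric := fun v w => by
    rw [← hg' v, ← hg' w, ← hmul i _ (hW _), ← hmul i _ (hW _), hinner i (hW _) (hW _)]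
  refine ⟨T, hsymm, fun i j _ => LinearMap.ext fun v => ext_inner_right ℝ fun w => ?_, hmul⟩
  -- Symmetry puts one variable on each side of the inner product, since both on one side could
  -- exceed degree `t + 1`. Both orders then give `Λ` of the same product.
  rw [Module.End.mul_apply, Module.End.mul_apply, hsymm i (T j v), hsymm j (T i v), ← hg' v, ← hg' w]
  simp only [← hmul _ _ (hW _)]
  rw [hφ _ _ (hX _ (hW _)) (hX _ (hW _)), hφ _ _ (hX _ (hW _)) (hX _ (hW _))]
  congr 1
  ring

/-- In a flat Gram realization of a linear functional on polynomials, the class of `1` is a sum of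
orthogonal vectors `e u` such that the class of `p` is `∑ p(u) e u`. -/
theorem exists_joint_eigenvectors (φ : MvPolynomial (Fin n) ℝ →ₗ[ℝ] E)
    (Λ : MvPolynomial (Fin n) ℝ →ₗ[ℝ] ℝ)
    (hφ : ∀ p q, p.totalDegree ≤ t + 1 → q.totalDegree ≤ t + 1 → ⟪φ p, φ q⟫_ℝ = Λ (p * q))
    (hsurj : ∀ v, ∃ p, p.totalDegree ≤ t ∧ φ p = v) :
    ∃ (S : Finset (Fin n → ℝ)) (e : (Fin n → ℝ) → E), (∀ u ∈ S, e u ≠ 0) ∧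
      (Pairwise fun u v => ⟪e u, e v⟫_ℝ = 0) ∧
      ∀ p, p.totalDegree ≤ t + 1 → φ p = ∑ u ∈ S, MvPolynomial.eval u p • e u := by
  obtain ⟨T, hsymm, hcomm, hT⟩ := exists_multiplication_operators φ Λ hφ hsurj
  -- Commuting symmetric operators are jointly diagonalizable. The indices `χ` of joint eigenspaces
  -- are points of `ℝ^n`, and those occurring in `φ 1` become the atoms.
  have h1 : φ 1 ∈ ⨆ χ : Fin n → ℝ, ⨅ i, Module.End.eigenspace (T i) (χ i) := by
    rw [LinearMap.IsSymmetric.iSup_iInf_eq_top_of_commute hsymm hcomm]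
    trivial
  obtain ⟨e, he, hsum⟩ := (Submodule.mem_iSup_iff_exists_finsupp _ _).1 h1
  refine ⟨e.support, e, fun u hu => Finsupp.mem_support_iff.1 hu, fun u v huv =>
    (LinearMap.IsSymmetric.orthogonalFamily_iInf_eigenspaces hsymm) huv ⟨_, he u⟩ ⟨_, he v⟩, ?_⟩
  have heig (u : Fin n → ℝ) (i : Fin n) : T i (e u) = u i • e u :=
    Module.End.mem_eigenspace_iff.1 ((Submodule.mem_iInf _).1 (he u) i)
  have hmono (d : ℕ) : ∀ α : Fin n →₀ ℕ, α.degree = d → d ≤ t + 1 →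
      φ (mono α) = ∑ u ∈ e.support, MvPolynomial.eval u (mono α) • e u := by
    induction d with
    | zero =>
      intro α hα _
      obtain rfl : α = 0 := (Finsupp.degree_eq_zero_iff α).1 hα
      simpa [mono, Finsupp.sum] using hsum.symm
    | succ d ih =>
      intro α hα hd
      obtain ⟨i, β, rfl, hβ⟩ := Finsupp.exists_eq_single_add_of_degree_eq_succ hα
      rw [← mono_mul_mono]
      change φ (MvPolynomial.X i * mono β) =
        ∑ u ∈ e.support, MvPolynomial.eval u (MvPolynomial.X i * mono β) • e u
      rw [hT _ _ (by rw [totalDegree_mono]; omega), ih β hβ (by omega), map_sum]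
      refine Finset.sum_congr rfl fun u _ => ?_
      rw [map_smul, heig, smul_smul, map_mul, MvPolynomial.eval_X, mul_comm]
  intro p hp
  have := LinearMap.eq_of_eq_on_mono (F := φ) (s := t + 1)
    (G := ∑ u ∈ e.support, (MvPolynomial.aeval u).toLinearMap.smulRight (e u))
    (fun α hα => by
      rw [hmono _ α rfl hα]
      simp [MvPolynomial.aeval_eq_eval]) hp
  rw [this]
  simp [MvPolynomial.aeval_eq_eval]

/-- Flat extension theorem for a Gram realization: the functional is an evaluation on
`finrank E` points, which are separated by polynomials of degree at most `s`. -/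
theorem exists_atoms_of_flat_realization {s : ℕ} (hs : s ≤ t) (φ : MvPolynomial (Fin n) ℝ →ₗ[ℝ] E)
    (Λ : MvPolynomial (Fin n) ℝ →ₗ[ℝ] ℝ)
    (hφ : ∀ p q, p.totalDegree ≤ t + 1 → q.totalDegree ≤ t + 1 → ⟪φ p, φ q⟫_ℝ = Λ (p * q))
    (hsurj : ∀ v, ∃ p, p.totalDegree ≤ s ∧ φ p = v) :
    ∃ (S : Finset (Fin n → ℝ)) (w : (Fin n → ℝ) → ℝ), S.card = Module.finrank ℝ E ∧
      (∀ u ∈ S, 0 < w u) ∧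
      (∀ p, p.totalDegree ≤ 2 * (t + 1) → Λ p = ∑ u ∈ S, w u * MvPolynomial.eval u p) ∧
      ∀ u ∈ S, ∃ p, p.totalDegree ≤ s ∧ MvPolynomial.eval u p = 1 ∧
        ∀ v ∈ S, v ≠ u → MvPolynomial.eval v p = 0 := by
  classical
  obtain ⟨S, e, hne, horth, he⟩ := exists_joint_eigenvectors φ Λ hφ
    fun v => (hsurj v).imp fun p hp => ⟨hp.1.trans hs, hp.2⟩
  have hli : LinearIndependent ℝ (fun u : S => e u) :=
    linearIndependent_of_ne_zero_of_inner_eq_zero (𝕜 := ℝ) (fun u => hne u u.2)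
      fun u v huv => horth (Subtype.coe_injective.ne huv)
  have hspan : ⊤ ≤ Submodule.span ℝ (Set.range fun u : S => e u) := fun v _ => by
    obtain ⟨p, hp, rfl⟩ := hsurj v
    rw [he p (by omega)]
    exact Submodule.sum_mem _ fun u hu =>
      Submodule.smul_mem _ _ (Submodule.subset_span ⟨⟨u, hu⟩, rfl⟩)
  -- The weights are the squared norms of the components of `φ 1`. The vectors `e u` form a basis,
  -- which counts the atoms.
  refine ⟨S, fun u => ⟪e u, e u⟫_ℝ, ?_, fun u hu => real_inner_self_pos.2 (hne u hu), ?_, ?_⟩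
  · rw [Module.finrank_eq_card_basis (Module.Basis.mk hli hspan), Fintype.card_coe]
  · intro p hp
    have := LinearMap.eq_of_eq_on_mono (F := Λ) (s := 2 * (t + 1))
      (G := ∑ u ∈ S, ⟪e u, e u⟫_ℝ • (MvPolynomial.aeval u).toLinearMap)
      (fun γ hγ => by
        obtain ⟨α, β, rfl, hα, hβ⟩ :=
          Finsupp.exists_add_of_degree_le (a := t + 1) (b := t + 1) (γ := γ) (by omega)
        rw [← totalDegree_mono] at hα hβ
        rw [← mono_mul_mono, ← hφ _ _ hα hβ, he _ hα, he _ hβ, sum_inner]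
        simp only [LinearMap.sum_apply, LinearMap.smul_apply, AlgHom.toLinearMap_apply,
          MvPolynomial.aeval_eq_eval, map_mul, smul_eq_mul]
        refine Finset.sum_congr rfl fun u hu => ?_
        rw [inner_sum, Finset.sum_eq_single_of_mem u hu fun v _ hv => by
          rw [real_inner_smul_left, real_inner_smul_right, horth hv.symm]; simp]
        rw [real_inner_smul_left, real_inner_smul_right]
        simp
        ring) hp
    rw [this]
    simp [MvPolynomial.aeval_eq_eval]
  · intro u hu
    -- A preimage of `e u` has coordinates `p(v)` in the basis `e`, hence the values `1` at `u` and
    -- `0` at the other atoms.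
    obtain ⟨p, hp, hpu⟩ := hsurj (e u)
    refine ⟨p, hp, ?_⟩
    rw [he p (by omega)] at hpu
    have h0 : ∑ v : S, (MvPolynomial.eval v.1 p - if v.1 = u then 1 else 0) • e v = 0 := by
      rw [Finset.sum_coe_sort S
        fun v => (MvPolynomial.eval v p - if v = u then 1 else 0) • e v]
      simp [sub_smul, hpu, hu]
    have h := Fintype.linearIndependent_iff.1 hli _ h0
    refine ⟨by simpa [sub_eq_zero] using h ⟨u, hu⟩, fun v hv hvu => ?_⟩
    simpa [hvu] using h ⟨v, hv⟩

end FlatExtension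

theorem momentMatrix_apply {n d k : ℕ} (y : Tms n d) (α β : PowIdx n k) :
    momentMatrix k y α β = y.riesz (mono α.1 * mono β.1) := rfl

/-- Flat extension theorem of Curto and Fialkow. -/
theorem exists_atoms_of_flat {n d s t : ℕ} (hst : s < t) (y : Tms n d)
    (hpsd : (momentMatrix t y).PosSemidef)
    (hrank : (momentMatrix s y).rank = (momentMatrix t y).rank) :
    ∃ (S : Finset (Fin n → ℝ)) (w : (Fin n → ℝ) → ℝ), S.card = (momentMatrix t y).rank ∧
      (∀ u ∈ S, 0 < w u) ∧
      (∀ p, p.totalDegree ≤ 2 * t → y.riesz p = ∑ u ∈ S, w u * MvPolynomial.eval u p) ∧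
      ∀ u ∈ S, ∃ p, p.totalDegree ≤ s ∧ MvPolynomial.eval u p = 1 ∧
        ∀ v ∈ S, v ≠ u → MvPolynomial.eval v p = 0 := by
  classical
  obtain ⟨v, hv⟩ := hpsd.exists_gram
  have hv' (α β : PowIdx n t) : ⟪v α, v β⟫_ℝ = y.riesz (mono α.1 * mono β.1) :=
    congrFun (congrFun hv α) β
  let φ : MvPolynomial (Fin n) ℝ →ₗ[ℝ] EuclideanSpace ℝ (Fin (momentMatrix t y).rank) :=
    ∑ α : PowIdx n t, (MvPolynomial.lcoeff ℝ α.1).smulRight (v α)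
  have hφv (α : PowIdx n t) : φ (mono α.1) = v α := by
    simp [φ, mono, MvPolynomial.coeff_monomial, Subtype.coe_inj]
  let ι (α : PowIdx n s) : PowIdx n t := ⟨α.1, α.2.trans hst.le⟩
  -- The only use of flatness: the vectors of degree at most `s` span a subspace of dimension `rank
  -- M_s = rank M_t`, the whole space.
  have hspan : Submodule.span ℝ (Set.range (v ∘ ι)) = ⊤ := by
    refine Submodule.eq_top_of_finrank_eq ?_
    have : Matrix.gram ℝ (v ∘ ι) = momentMatrix s y := by
      ext α β
      exact hv' (ι α) (ι β)
    rw [← rank_gram_eq_finrank_span, this, hrank, finrank_euclideanSpace_fin]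
  obtain ⟨t, rfl⟩ := Nat.exists_eq_add_one_of_ne_zero (Nat.ne_zero_of_lt hst)
  have := exists_atoms_of_flat_realization (t := t) (Nat.le_of_lt_succ hst) φ y.rieszₗ ?_ ?_
  · rwa [finrank_euclideanSpace_fin] at this
  · intro p q hp hq
    rw [← sum_coeff_smul_mono hp, ← sum_coeff_smul_mono hq]
    simp only [Finset.sum_mul_sum, map_sum, map_smul, hφv, sum_inner, inner_sum, smul_mul_assoc,
      mul_smul_comm, real_inner_smul_left, real_inner_smul_right, hv', smul_eq_mul,
      Tms.rieszₗ_apply]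
    exact Finset.sum_comm
  · intro x
    have hx : x ∈ Submodule.span ℝ (Set.range (v ∘ ι)) := hspan ▸ Submodule.mem_top
    have hle : Submodule.span ℝ (Set.range (v ∘ ι)) ≤
        (MvPolynomial.restrictTotalDegree (Fin n) ℝ s).map φ := by
      rw [Submodule.span_le]
      rintro _ ⟨α, rfl⟩
      exact ⟨mono α.1, (MvPolynomial.mem_restrictTotalDegree _ _ _).2
        ((totalDegree_mono _).trans_le α.2), hφv (ι α)⟩
    obtain ⟨p, hp, rfl⟩ := hle hx
    exact ⟨p, (MvPolynomial.mem_restrictTotalDegree _ _ _).1 hp, rfl⟩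

/-! ### Localizing conditions and scaling -/

section Localizing

variable {n d k : ℕ} {y : Tms n d}

/-- This is the quadratic form of the localizing matrix at the coefficient vector of `p`. -/
theorem riesz_mul_sq_nonneg {c p : MvPolynomial (Fin n) ℝ}
    (h : (localizingMatrix k c y).PosSemidef) (hp : p.totalDegree ≤ k - halfDeg c) :
    0 ≤ y.riesz (c * (p * p)) := by
  rw [riesz_mul_eq_sum y c hp hp]
  refine (h.dotProduct_mulVec_nonneg fun α => p.coeff α.1).trans_eq ?_
  simp only [dotProduct, Matrix.mulVec, Finset.mul_sum, localizingMatrix, Matrix.of_apply,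
    Pi.star_apply, star_trivial]
  refine Finset.sum_congr rfl fun α _ => Finset.sum_congr rfl fun β _ => ?_
  ring

theorem riesz_mul_eq_zero {c q : MvPolynomial (Fin n) ℝ} (h : localizingVector c y = 0)
    (hq : q.totalDegree ≤ d - c.totalDegree) : y.riesz (c * q) = 0 := by
  have := LinearMap.eq_of_eq_on_mono (F := y.rieszₗ ∘ₗ LinearMap.mulLeft ℝ c) (G := 0)
    (fun α hα => congrFun h ⟨α, hα⟩) hq
  simpa using this

theorem posSemidef_momentMatrix_of_le {t : ℕ} (htk : t ≤ k) (h : (momentMatrix k y).PosSemidef) :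
    (momentMatrix t y).PosSemidef :=
  h.submatrix fun α : PowIdx n t => (⟨α.1, α.2.trans htk⟩ : PowIdx n k)

theorem Tms.riesz_one (y : Tms n d) : y.riesz 1 = y.zeroth := y.riesz_mono ⟨0, by simp⟩

theorem zeroth_nonneg (h : (momentMatrix k y).PosSemidef) : 0 ≤ y.zeroth := by
  have := h.diag_nonneg (i := ⟨0, by simp⟩)
  rw [momentMatrix_apply, mono_mul_mono, add_zero] at this
  exact this.trans_eq y.riesz_one

theorem Tms.riesz_smul (a : ℝ) (y : Tms n d) (p : MvPolynomial (Fin n) ℝ) :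
    (a • y).riesz p = a * y.riesz p := by
  simp [Tms.riesz, Finset.mul_sum, mul_left_comm]

theorem localizingMatrix_smul (a : ℝ) (c : MvPolynomial (Fin n) ℝ) :
    localizingMatrix k c (a • y) = a • localizingMatrix k c y := by
  ext α β
  simp [localizingMatrix, Tms.riesz_smul]

theorem momentMatrix_smul (a : ℝ) : momentMatrix k (a • y) = a • momentMatrix k y := by
  ext α β
  simp [momentMatrix, Tms.riesz_smul]

theorem localizingVector_smul (a : ℝ) (c : MvPolynomial (Fin n) ℝ) :
    localizingVector c (a • y) = a • localizingVector c y := by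
  ext α
  simp [localizingVector, Tms.riesz_smul]

end Localizing

/-! ### Point evaluations -/

section Evaluation

variable {n d : ℕ}

/-- The truncated multi-sequence of the monomials evaluated at a point. -/
def evalTms (d : ℕ) (x : Fin n → ℝ) : Tms n d := fun α => MvPolynomial.eval x (mono α.1)

theorem riesz_evalTms (x : Fin n → ℝ) {p : MvPolynomial (Fin n) ℝ} (hp : p.totalDegree ≤ d) :
    (evalTms d x).riesz p = MvPolynomial.eval x p := by
  conv_rhs => rw [← sum_coeff_smul_mono hp]
  simp [Tms.riesz, evalTms, MvPolynomial.smul_eval]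

theorem zeroth_evalTms (x : Fin n → ℝ) : (evalTms d x).zeroth = 1 := by
  rw [← Tms.riesz_one, riesz_evalTms x (by simp), map_one]

/-- At a point the matrix has the form `c(x) a aᵀ`, with `a` the vector of monomial values. -/
theorem posSemidef_localizingMatrix_evalTms {k : ℕ} {x : Fin n → ℝ} {c : MvPolynomial (Fin n) ℝ}
    (hc : halfDeg c ≤ k) (hx : 0 ≤ MvPolynomial.eval x c) :
    (localizingMatrix k c (evalTms (2 * k) x)).PosSemidef := by
  let a (α : PowIdx n (k - halfDeg c)) : ℝ := MvPolynomial.eval x (mono α.1)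
  have : localizingMatrix k c (evalTms (2 * k) x) =
      MvPolynomial.eval x c • Matrix.vecMulVec a (star a) := by
    ext α β
    have hdeg : (c * (mono α.1 * mono β.1)).totalDegree ≤ 2 * k := by
      have h1 := MvPolynomial.totalDegree_mul c (mono α.1 * mono β.1)
      rw [mono_mul_mono, totalDegree_mono, map_add] at h1
      have := α.2
      have := β.2
      rw [mono_mul_mono]
      unfold halfDeg at *
      omega
    simp [localizingMatrix, riesz_evalTms x hdeg, a, Matrix.vecMulVec_apply]
  rw [this]
  exact (Matrix.posSemidef_vecMulVec_self_star a).smul hx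

theorem posSemidef_momentMatrix_of_localizingMatrix_one {k : ℕ} (y : Tms n d)
    (h : (localizingMatrix k 1 y).PosSemidef) : (momentMatrix k y).PosSemidef := by
  have := h.submatrix fun α : PowIdx n k =>
    (⟨α.1, by simpa [halfDeg] using α.2⟩ : PowIdx n (k - halfDeg (1 : MvPolynomial (Fin n) ℝ)))
  convert this using 1
  ext α β
  simp [momentMatrix, localizingMatrix]

theorem localizingVector_evalTms {x : Fin n → ℝ} {c : MvPolynomial (Fin n) ℝ}
    (hc : c.totalDegree ≤ d) (hx : MvPolynomial.eval x c = 0) :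
    localizingVector c (evalTms d x) = 0 := by
  ext α
  have hdeg : (c * mono α.1).totalDegree ≤ d := by
    have h1 := MvPolynomial.totalDegree_mul c (mono α.1)
    rw [totalDegree_mono] at h1
    have := α.2
    omega
  simp [localizingVector, riesz_evalTms x hdeg, hx]

end Evaluation

/-! ### Finitely atomic measures -/

section AtomicMeasure

variable {n : ℕ}

/-- The measure `∑_{u ∈ S} w_u δ_u`. -/
def atomicMeasure (S : Finset (Fin n → ℝ)) (w : (Fin n → ℝ) → ℝ) : Measure (Fin n → ℝ) :=
  ∑ u ∈ S, ENNReal.ofReal (w u) • Measure.dirac u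

variable {S : Finset (Fin n → ℝ)} {w : (Fin n → ℝ) → ℝ}

theorem support_atomicMeasure (hw : ∀ u ∈ S, 0 < w u) : (atomicMeasure S w).support = S := by
  apply subset_antisymm
  · refine Measure.support_subset_of_isClosed S.finite_toSet.isClosed ?_
    rw [mem_ae_iff, atomicMeasure, Measure.finsetSum_apply]
    refine Finset.sum_eq_zero fun u hu => ?_
    simp [Measure.dirac_apply' _ S.finite_toSet.measurableSet.compl, hu]
  · intro u hu
    rw [Measure.mem_support_iff_forall]
    intro U hU
    rw [atomicMeasure, Measure.finsetSum_apply]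
    refine lt_of_lt_of_le ?_ (Finset.single_le_sum (fun _ _ => zero_le) hu)
    simp [Measure.dirac_apply_of_mem (mem_of_mem_nhds hU), hw u hu]

theorem integrable_atomicMeasure (g : (Fin n → ℝ) → ℝ) : Integrable g (atomicMeasure S w) :=
  integrable_finsetSum_measure.2 fun _ _ =>
    (integrable_dirac enorm_lt_top).smul_measure ENNReal.ofReal_ne_top

theorem integral_atomicMeasure (hw : ∀ u ∈ S, 0 < w u) (g : (Fin n → ℝ) → ℝ) :
    ∫ x, g x ∂atomicMeasure S w = ∑ u ∈ S, w u * g u := by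
  rw [atomicMeasure, integral_finsetSum_measure fun _ _ =>
    (integrable_dirac enorm_lt_top).smul_measure ENNReal.ofReal_ne_top]
  refine Finset.sum_congr rfl fun u hu => ?_
  rw [integral_smul_measure, integral_dirac, ENNReal.toReal_ofReal (hw u hu).le, smul_eq_mul]

theorem admits_atomicMeasure {d : ℕ} {y : Tms n d} (hw : ∀ u ∈ S, 0 < w u)
    (h : ∀ α : PowIdx n d, y α = ∑ u ∈ S, w u * MvPolynomial.eval u (mono α.1)) :
    y.Admits (atomicMeasure S w) := fun α =>
  ⟨integrable_atomicMeasure _, by simp [h, integral_atomicMeasure hw, eval_mono]⟩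

end AtomicMeasure

/-! ### The unified moment relaxation -/

namespace UnionProblem

variable {n m : ℕ} {P : UnionProblem n m} {k : ℕ} {y : Fin m → Tms n (2 * k)}

theorem halfDeg_le_degBound {l : Fin m} {i : ℕ} (hi : i ∈ P.E l ∪ P.I l) :
    halfDeg (P.c l i) ≤ P.degBound l :=
  (Finset.le_sup (f := fun i => halfDeg (P.c l i)) hi).trans (le_max_right _ _)

theorem one_le_degBound (l : Fin m) : 1 ≤ P.degBound l := le_max_left _ _

theorem sum_riesz_update (l : Fin m) (z : Tms n (2 * k)) (p : MvPolynomial (Fin n) ℝ) :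
    ∑ i, (Function.update y l z i).riesz p + (y l).riesz p =
      ∑ i, (y i).riesz p + z.riesz p := by
  rw [← Finset.add_sum_erase _ _ (Finset.mem_univ l),
    ← Finset.add_sum_erase Finset.univ (fun i => (y i).riesz p) (Finset.mem_univ l),
    Function.update_self, Finset.sum_congr rfl fun i hi => by
      rw [Function.update_of_ne (Finset.ne_of_mem_erase hi)]]
  ring

/-- The feasible tuples with a component of mass zero are invariant under scaling it. -/
theorem IsFeasible.update_smul (h : P.IsFeasible k y) {l : Fin m} (hl : (y l).zeroth = 0)
    {a : ℝ} (ha : 0 ≤ a) : P.IsFeasible k (Function.update y l (a • y l)) where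
  eq_constraint j i hi := by
    obtain rfl | hj := eq_or_ne j l
    · rw [Function.update_self, localizingVector_smul, h.eq_constraint j i hi, smul_zero]
    · rw [Function.update_of_ne hj, h.eq_constraint j i hi]
  ineq_constraint j i hi := by
    obtain rfl | hj := eq_or_ne j l
    · rw [Function.update_self, localizingMatrix_smul]
      exact (h.ineq_constraint j i hi).smul ha
    · rw [Function.update_of_ne hj]
      exact h.ineq_constraint j i hi
  moment j := by
    obtain rfl | hj := eq_or_ne j l
    · rw [Function.update_self, momentMatrix_smul]
      exact (h.moment j).smul ha
    · rw [Function.update_of_ne hj]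
      exact h.moment j
  mass := by
    have := sum_riesz_update (y := y) l (a • y l) 1
    rw [Tms.riesz_smul] at this
    simpa [Tms.riesz_one, hl, h.mass] using this

/-- Mass zero does not force the entries of degree `2k` to vanish, so optimality is needed. Scaling
such a component by `a ≥ 0` keeps feasibility; `a = 0` and `a = 2` give the two inequalities. -/
theorem IsRelaxationMinimizer.riesz_eq_zero (h : P.IsRelaxationMinimizer k y) {l : Fin m}
    (hl : (y l).zeroth = 0) : (y l).riesz P.f = 0 := by
  have key (a : ℝ) (ha : 0 ≤ a) : (y l).riesz P.f ≤ a * (y l).riesz P.f := by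
    have h1 := h.2 _ (h.1.update_smul hl ha)
    have h2 := sum_riesz_update (y := y) l (a • y l) P.f
    rw [Tms.riesz_smul] at h2
    unfold objective at h1
    linarith
  linarith [key 0 le_rfl, key 2 zero_le_two]

/-- A point of `K_l` gives a feasible tuple. -/
theorem isFeasible_single (hk : ∀ l, P.degBound l ≤ k) {l : Fin m} {x : Fin n → ℝ}
    (hx : x ∈ P.K l) : P.IsFeasible k (Pi.single l (evalTms (2 * k) x)) where
  eq_constraint j i hi := by
    obtain rfl | hj := eq_or_ne j l
    · rw [Pi.single_eq_same]
      refine localizingVector_evalTms ?_ (hx.1 i hi)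
      have := (P.halfDeg_le_degBound (Finset.mem_union_left _ hi)).trans (hk j)
      unfold halfDeg at this
      omega
    · rw [Pi.single_eq_of_ne hj]
      simpa using localizingVector_smul (y := (0 : Tms n (2 * k))) 0 (P.c j i)
  ineq_constraint j i hi := by
    obtain rfl | hj := eq_or_ne j l
    · rw [Pi.single_eq_same]
      exact posSemidef_localizingMatrix_evalTms
        ((P.halfDeg_le_degBound (Finset.mem_union_right _ hi)).trans (hk j)) (hx.2 i hi)
    · rw [Pi.single_eq_of_ne hj, ← zero_smul ℝ (0 : Tms n (2 * k)), localizingMatrix_smul,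
        zero_smul]
      exact Matrix.PosSemidef.zero
  moment j := by
    obtain rfl | hj := eq_or_ne j l
    · rw [Pi.single_eq_same]
      exact posSemidef_momentMatrix_of_localizingMatrix_one _
        (posSemidef_localizingMatrix_evalTms (by simp [halfDeg]) (by simp))
    · rw [Pi.single_eq_of_ne hj, ← zero_smul ℝ (0 : Tms n (2 * k)), momentMatrix_smul, zero_smul]
      exact Matrix.PosSemidef.zero
  mass := by
    rw [Finset.sum_eq_single_of_mem l (Finset.mem_univ l) fun j _ hj => by
      rw [Pi.single_eq_of_ne hj]; rfl, Pi.single_eq_same, zeroth_evalTms]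

theorem objective_single (hf : P.f.totalDegree ≤ 2 * k) (l : Fin m) (x : Fin n → ℝ) :
    P.objective (Pi.single l (evalTms (2 * k) x)) = MvPolynomial.eval x P.f := by
  rw [objective, Finset.sum_eq_single_of_mem l (Finset.mem_univ l) fun j _ hj => by
    rw [Pi.single_eq_of_ne hj]; simp [Tms.riesz], Pi.single_eq_same, riesz_evalTms x hf]

theorem IsRelaxationMinimizer.objective_le_eval (h : P.IsRelaxationMinimizer k y)
    (hk : ∀ l, P.degBound l ≤ k) (hf : P.f.totalDegree ≤ 2 * k) {x : Fin n → ℝ}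
    (hx : x ∈ P.feasibleSet) : P.objective y ≤ MvPolynomial.eval x P.f := by
  obtain ⟨l, hl⟩ := Set.mem_iUnion.1 hx
  exact (h.2 _ (isFeasible_single hk hl)).trans_eq (objective_single hf l x)

theorem IsRelaxationMinimizer.fMom_eq (h : P.IsRelaxationMinimizer k y) :
    P.fMom k = (P.objective y : ℝ) :=
  le_antisymm (iInf₂_le y h.1) (le_iInf₂ fun z hz => EReal.coe_le_coe (h.2 z hz))

theorem IsMinimizer.fMin_eq {u : Fin n → ℝ} (h : P.IsMinimizer u) :
    P.fMin = (MvPolynomial.eval u P.f : ℝ) :=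
  le_antisymm (iInf₂_le u h.1) (le_iInf₂ fun x hx => EReal.coe_le_coe (h.2 x hx))

/-- Under flatness, the atoms of the component `y l` lie in `K_l`. -/
theorem IsFeasible.exists_atoms (h : P.IsFeasible k y) {t : ℕ} (htk : t ≤ k) {l : Fin m}
    (htd : P.degBound l ≤ t)
    (hflat : (momentMatrix (t - P.degBound l) (y l)).rank = (momentMatrix t (y l)).rank) :
    ∃ (S : Finset (Fin n → ℝ)) (w : (Fin n → ℝ) → ℝ), S.card = (momentMatrix t (y l)).rank ∧
      (∀ u ∈ S, 0 < w u) ∧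
      (∀ p, p.totalDegree ≤ 2 * t → (y l).riesz p = ∑ u ∈ S, w u * MvPolynomial.eval u p) ∧
      (S : Set (Fin n → ℝ)) ⊆ P.K l := by
  have h1 := P.one_le_degBound l
  obtain ⟨S, w, hcard, hw, hint, hsep⟩ := exists_atoms_of_flat
    (show t - P.degBound l < t by omega) (y l) (posSemidef_momentMatrix_of_le htk (h.moment l))
    hflat
  -- The square of the separating polynomial keeps only the atom `u`. The degree fits, since `deg c
  -- ≤ 2 d_l` and `deg p ≤ t - d_l`.
  have key {u : Fin n → ℝ} (hu : u ∈ S) {i : ℕ} (hi : i ∈ P.E l ∪ P.I l) :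
      ∃ p, p.totalDegree ≤ t - P.degBound l ∧
        (y l).riesz (P.c l i * (p * p)) = w u * MvPolynomial.eval u (P.c l i) := by
    obtain ⟨p, hp, hpu, hpv⟩ := hsep u hu
    have hc := P.halfDeg_le_degBound hi
    refine ⟨p, hp, ?_⟩
    rw [hint, Finset.sum_eq_single_of_mem u hu fun v hv hvu => by simp [hpv v hv hvu]]
    · simp [hpu]
    · have h2 := MvPolynomial.totalDegree_mul (P.c l i) (p * p)
      have h3 := MvPolynomial.totalDegree_mul p p
      unfold halfDeg at hc
      omega
  refine ⟨S, w, hcard, hw, hint, fun u hu => ⟨fun i hi => ?_, fun j hj => ?_⟩⟩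
  · have hc := P.halfDeg_le_degBound (Finset.mem_union_left _ hi)
    obtain ⟨p, hp, hpu⟩ := key hu (Finset.mem_union_left _ hi)
    rw [riesz_mul_eq_zero (h.eq_constraint l i hi)] at hpu
    · simpa [(hw u hu).ne'] using hpu.symm
    · have h3 := MvPolynomial.totalDegree_mul p p
      unfold halfDeg at hc
      omega
  · have hc := P.halfDeg_le_degBound (Finset.mem_union_right _ hj)
    obtain ⟨p, hp, hpu⟩ := key hu (Finset.mem_union_right _ hj)
    have := riesz_mul_sq_nonneg (h.ineq_constraint l j hj) (hp.trans (by omega))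
    rw [hpu] at this
    exact nonneg_of_mul_nonneg_right this (hw u hu)

end UnionProblem

/-! ### Tightness and the count of minimizers -/

/-- A value below all values of a function and equal to a convex combination with positive weights
is attained at every point. -/
theorem eq_of_sum_mul_eq {ι : Type*} {s : Finset ι} {w g : ι → ℝ} {a : ℝ}
    (hw : ∀ i ∈ s, 0 < w i) (hsum : ∑ i ∈ s, w i = 1) (hle : ∀ i ∈ s, a ≤ g i)
    (heq : a = ∑ i ∈ s, w i * g i) : ∀ i ∈ s, g i = a := by
  have h0 : ∑ i ∈ s, w i * (g i - a) = 0 := by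
    simp_rw [mul_sub, Finset.sum_sub_distrib, ← Finset.sum_mul, hsum, ← heq]
    ring
  intro i hi
  have h1 := (Finset.sum_eq_zero_iff_of_nonneg fun j hj =>
    mul_nonneg (hw j hj).le (sub_nonneg.2 (hle j hj))).1 h0 i hi
  have := (mul_eq_zero.1 h1).resolve_left (hw i hi).ne'
  linarith

end

open Classical in
theorem theorem3p5 {n m : ℕ} (P : UnionProblem n m) (k t : ℕ)
    (y : Fin m → Tms n (2 * k)) (hy : P.IsRelaxationMinimizer k y)
    (htk : t ≤ k) (htd : ∀ l, P.degBound l ≤ t) (htf : P.f.totalDegree ≤ 2 * t)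
    (hflat : ∀ l ∈ activeLabels y,
      (momentMatrix (t - P.degBound l) (y l)).rank = (momentMatrix t (y l)).rank) :
    P.fMom k = P.fMin ∧
    ∃ μ : Fin m → Measure (Fin n → ℝ),
      (∀ l ∈ activeLabels y,
        ((y l).truncate (Nat.mul_le_mul_left 2 htk)).Admits (μ l) ∧
        IsAtomicMeasure (momentMatrix t (y l)).rank (μ l) ∧
        (μ l).support ⊆ P.K l ∧
        ∀ u ∈ (μ l).support, P.IsMinimizer u) ∧
      -- the minimizers found, counted once for each label
      {q : Fin m × (Fin n → ℝ) | q.1 ∈ activeLabels y ∧ q.2 ∈ (μ q.1).support}.ncard =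
        ∑ l with l ∈ activeLabels y, (momentMatrix t (y l)).rank ∧
      -- without repetition when the sets in the union are disjoint
      ((activeLabels y).PairwiseDisjoint P.K →
        (⋃ l ∈ activeLabels y, (μ l).support).ncard =
          ∑ l with l ∈ activeLabels y, (momentMatrix t (y l)).rank) := by
  have hex (l : Fin m) : ∃ (S : Finset (Fin n → ℝ)) (w : (Fin n → ℝ) → ℝ), l ∈ activeLabels y →
      S.card = (momentMatrix t (y l)).rank ∧ (∀ u ∈ S, 0 < w u) ∧
      (∀ p, p.totalDegree ≤ 2 * t → (y l).riesz p = ∑ u ∈ S, w u * MvPolynomial.eval u p) ∧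
      (S : Set (Fin n → ℝ)) ⊆ P.K l := by
    by_cases hl : l ∈ activeLabels y
    · obtain ⟨S, w, h⟩ := hy.1.exists_atoms htk (htd l) (hflat l hl)
      exact ⟨S, w, fun _ => h⟩
    · exact ⟨∅, 0, fun h => absurd h hl⟩
  choose S w hS using hex
  let A : Finset (Fin m) := {l | l ∈ activeLabels y}
  have hA {l : Fin m} : l ∈ A ↔ l ∈ activeLabels y := by simp [A]
  have hcard (l) (hl : l ∈ A) := (hS l (hA.1 hl)).1
  have hw (l) (hl : l ∈ A) := (hS l (hA.1 hl)).2.1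
  have hint (l) (hl : l ∈ A) := (hS l (hA.1 hl)).2.2.1
  have hK (l) (hl : l ∈ A) := (hS l (hA.1 hl)).2.2.2
  have hzero (l : Fin m) (hl : l ∉ A) : (y l).zeroth = 0 :=
    le_antisymm (not_lt.1 fun h => hl (hA.2 h)) (zeroth_nonneg (hy.1.moment l))
  -- Atoms are indexed by pairs `(l, u)`, so a point occurring for several labels keeps a separate
  -- weight for each.
  have hmass : ∑ q ∈ A.sigma S, w q.1 q.2 = 1 := by
    rw [Finset.sum_sigma, ← hy.1.mass, ← Finset.sum_subset (Finset.subset_univ A)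
      fun l _ hl => hzero l hl]
    refine Finset.sum_congr rfl fun l hl => ?_
    rw [← Tms.riesz_one, hint l hl 1 (by simp)]
    simp
  have hobj : P.objective y = ∑ q ∈ A.sigma S, w q.1 q.2 * MvPolynomial.eval q.2 P.f := by
    rw [Finset.sum_sigma, UnionProblem.objective, ← Finset.sum_subset (Finset.subset_univ A)
      fun l _ hl => hy.riesz_eq_zero (hzero l hl)]
    exact Finset.sum_congr rfl fun l hl => hint l hl _ htf
  have hlow {x : Fin n → ℝ} (hx : x ∈ P.feasibleSet) : P.objective y ≤ MvPolynomial.eval x P.f :=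
    hy.objective_le_eval (fun l => (htd l).trans htk) (by omega) hx
  have hfeas (l) (hl : l ∈ A) (u) (hu : u ∈ S l) : u ∈ P.feasibleSet :=
    Set.mem_iUnion.2 ⟨l, hK l hl hu⟩
  have hval (l) (hl : l ∈ A) (u) (hu : u ∈ S l) : MvPolynomial.eval u P.f = P.objective y := by
    refine eq_of_sum_mul_eq (s := A.sigma S) (w := fun q => w q.1 q.2)
      (g := fun q => MvPolynomial.eval q.2 P.f) (fun q hq => ?_) hmass (fun q hq => ?_) hobj
      ⟨l, u⟩ (Finset.mem_sigma.2 ⟨hl, hu⟩)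
    · exact hw _ (Finset.mem_sigma.1 hq).1 _ (Finset.mem_sigma.1 hq).2
    · exact hlow (hfeas _ (Finset.mem_sigma.1 hq).1 _ (Finset.mem_sigma.1 hq).2)
  have hmin (l) (hl : l ∈ A) (u) (hu : u ∈ S l) : P.IsMinimizer u :=
    ⟨hfeas l hl u hu, fun x hx => (hval l hl u hu).trans_le (hlow hx)⟩
  have hsupp (l) (hl : l ∈ A) : (atomicMeasure (S l) (w l)).support = S l :=
    support_atomicMeasure (hw l hl)
  refine ⟨?_, fun l => atomicMeasure (S l) (w l), fun l hl => ?_, ?_, fun hdisj => ?_⟩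
  -- Total weight `1` forces an atom to exist; its value of `f` is both optimal values.
  · obtain ⟨⟨l, u⟩, hq⟩ : (A.sigma S).Nonempty :=
      Finset.nonempty_of_sum_ne_zero (hmass.trans_ne one_ne_zero)
    obtain ⟨hl, hu⟩ := Finset.mem_sigma.1 hq
    rw [hy.fMom_eq, (hmin l hl u hu).fMin_eq, hval l hl u hu]
  · have hl := hA.2 hl
    refine ⟨admits_atomicMeasure (hw l hl) fun α => ?_,
      ⟨S l, w l, hcard l hl, hw l hl, rfl⟩, (hsupp l hl).trans_subset (hK l hl), fun u hu => ?_⟩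
    · rw [← hint l hl _ ((totalDegree_mono _).trans_le α.2)]
      exact ((y l).riesz_mono ⟨α.1, α.2.trans (Nat.mul_le_mul_left 2 htk)⟩).symm
    · rw [hsupp l hl] at hu
      exact hmin l hl u hu
  · have : {q : Fin m × (Fin n → ℝ) | q.1 ∈ activeLabels y ∧
        q.2 ∈ (atomicMeasure (S q.1) (w q.1)).support} =
        ((A.sigma S).map (Equiv.sigmaEquivProd _ _).toEmbedding : Finset (Fin m × (Fin n → ℝ))) := by
      ext ⟨l, u⟩
      simp only [Set.mem_ofPred_eq, Finset.coe_map, Set.mem_image, Finset.mem_coe,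
        Finset.mem_sigma, ← hA]
      constructor
      · rintro ⟨hl, hu⟩
        rw [hsupp l hl] at hu
        exact ⟨⟨l, u⟩, ⟨hl, hu⟩, rfl⟩
      · rintro ⟨⟨l', u'⟩, ⟨hl, hu⟩, h⟩
        cases h
        exact ⟨hl, (hsupp _ hl).symm ▸ hu⟩
    rw [this, Set.ncard_coe_finset, Finset.card_map, Finset.card_sigma]
    exact Finset.sum_congr rfl hcard
  · have : (⋃ l ∈ activeLabels y, (atomicMeasure (S l) (w l)).support) =
        (A.biUnion S : Finset (Fin n → ℝ)) := by
      rw [Finset.coe_biUnion]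
      simp only [Finset.mem_coe, hA]
      exact Set.iUnion₂_congr fun l hl => hsupp l (hA.2 hl)
    rw [this, Set.ncard_coe_finset, Finset.card_biUnion]
    · exact Finset.sum_congr rfl hcard
    · intro i hi j hj hij
      rw [Function.onFun, ← Finset.disjoint_coe]
      exact (hdisj (hA.1 hi) (hA.1 hj) hij).mono (hK i hi) (hK j hj)
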